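/- Let $\mathfrak H$ be a complex Hilbert space with inner product $(\cdot,\cdot)$, linear in the first argument, and let $J$ be a non-trivial fundamental symmetry, i.e. $J=J^*$, $J^2=I$, $J\neq\pm I$. Put $[f,g]=(Jf,g)$. Let $H$ be a $J$-symmetric operator in $\mathfrak H$, i.e. $[Hf,g]=[f,Hg]$ for all $f,g\in D(H)$, with eigenvectors $\{f_n\}_{n=1}^\infty$ corresponding to pairwise distinct, simple, real eigenvalues $\{\lambda_n\}_{n=1}^\infty$. Assume that the linear span of $\{f_n\}$ is dense in $\mathfrak H$ and that the eigenvectors are normalized so that $[f_n,f_n]^2=1$. Let $\mathfrak L_+^0$ (respectively $\mathfrak L_-^0$) be the closed linear span in $\mathfrak H$ of those $f_n$ with $[f_n,f_n]>0$ (respectively $[f_n,f_n]<0$); the sum $\mathcal D_0=\mathfrak L_+^0\dotplus\mathfrak L_-^0$ is direct and dense in $\mathfrak H$. Define $\mathcal C_0(u+v)=u-v$ for $u\in\mathfrak L_+^0$, $v\in\mathfrak L_-^0$, and $G_0=J\mathcal C_0$, a closed positive symmetric operator with domain $\mathcal D_0$. Let $G_F$ be the Friedrichs extension of $G_0$, i.e.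 the restriction of $G_0^*$ to $D[G_0]\cap D(G_0^*)$, where $D[G_0]\subset\mathfrak H$ is the closure of $D(G_0)$ with respect to the norm $\|f\|_0^2=\|f\|^2+(G_0f,f)$. An operator $\mathcal C$ in $\mathfrak H$ is called an operator of $\mathcal C$-symmetry if $\mathcal C^2f=f$ for all $f\in D(\mathcal C)$ (in particular $\mathcal C$ maps $D(\mathcal C)$ into itself) and $J\mathcal C$ is a positive self-adjoint operator in $\mathfrak H$, where positive means $(J\mathcal Cf,f)>0$ for all nonzero $f\in D(\mathcal C)$. For such $\mathcal C$ let $\mathfrak H_{\mathcal C}$ be the completion of $D(\mathcal C)$ with respect to the inner product $(f,g)_{\mathcal C}=[\mathcal Cf,g]$. If $\mathcal C$ is an operator of $\mathcal C$-symmetry and $\mathcal C=JG_F$, then all $f_n$ belong to $D(\mathcal C)$, and $\{f_n\}$ is an orthonormal basis of the Hilbert space $(\mathfrak H_{\mathcal C},(\cdot,\cdot)_{\mathcal C})$. -/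

import Mathlib

open Filter Topology

noncomputable section

namespace KreinC

variable {E : Type*} [NormedAddCommGroup E] [InnerProductSpace ℂ E]

/-- The indefinite inner product `[x, y] = (J x, y)`. It is linear in `x`: the inner product
`(x, y)`, linear in the first argument, is `inner ℂ y x` in Mathlib's convention. -/
def krein (J : E →L[ℂ] E) (x y : E) : ℂ :=
  inner ℂ y (J x)

/-- `J` is a non-trivial fundamental symmetry: `J = J*`, `J² = I`, `J ≠ I` and `J ≠ -I`. -/
structure IsFundamentalSymmetry [CompleteSpace E] (J : E →L[ℂ] E) : Prop where
  selfAdjoint : IsSelfAdjoint J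
  sq_eq_one : J * J = 1
  ne_one : J ≠ 1
  ne_neg_one : J ≠ -1

/-- `H` is `J`-symmetric: `[H x, y] = [x, H y]` for all `x, y ∈ D(H)`. -/
def IsJSymmetric (J : E →L[ℂ] E) (H : E →ₗ.[ℂ] E) : Prop :=
  ∀ x y : H.domain, krein J (H x) y = krein J x (H y)

/-- `(f n)` is a complete (i.e. total) sequence of eigenvectors of `H` that belong to the pairwise
distinct real eigenvalues `lam n`. -/
structure IsCompleteEigensystem (H : E →ₗ.[ℂ] E) (lam : ℕ → ℝ) (f : ℕ → E) : Prop where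
  mem_domain : ∀ n, f n ∈ H.domain
  ne_zero : ∀ n, f n ≠ 0
  eigen : ∀ n, H ⟨f n, mem_domain n⟩ = (lam n : ℂ) • f n
  distinct : Function.Injective lam
  /-- Each eigenvalue is simple. -/
  simple : ∀ n, ∀ x : H.domain, H x = (lam n : ℂ) • (x : E) → (x : E) ∈ Submodule.span ℂ {f n}
  /-- The linear span of the eigenvectors is dense. -/
  complete : Dense (Submodule.span ℂ (Set.range f) : Set E)

/-- `𝔏₊⁰`: the closed linear span of the `f n` with `[f n, f n] > 0`. -/
def posSpace (J : E →L[ℂ] E) (f : ℕ → E) : Submodule ℂ E :=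
  (Submodule.span ℂ (f '' {n | 0 < (krein J (f n) (f n)).re})).topologicalClosure

/-- `𝔏₋⁰`: the closed linear span of the `f n` with `[f n, f n] < 0`. -/
def negSpace (J : E →L[ℂ] E) (f : ℕ → E) : Submodule ℂ E :=
  (Submodule.span ℂ (f '' {n | (krein J (f n) (f n)).re < 0})).topologicalClosure

/-- The graph `{(u + v, u - v) : u ∈ L₊, v ∈ L₋}`. -/
def sumGraph (Lp Lm : Submodule ℂ E) : Submodule ℂ (E × E) :=
  Lp.map (LinearMap.prod LinearMap.id LinearMap.id) ⊔
    Lm.map (LinearMap.prod LinearMap.id (-LinearMap.id))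

/-- The operator `u + v ↦ u - v` (`u ∈ L₊`, `v ∈ L₋`) with domain `L₊ ∔ L₋`. It is meant for
subspaces with `L₊ ∩ L₋ = 0`, see `sumOp_apply`. -/
def sumOp (Lp Lm : Submodule ℂ E) : E →ₗ.[ℂ] E :=
  (sumGraph Lp Lm).toLinearPMap

theorem mem_sumGraph {Lp Lm : Submodule ℂ E} {p : E × E} :
    p ∈ sumGraph Lp Lm ↔ ∃ u ∈ Lp, ∃ v ∈ Lm, p = (u + v, u - v) := by
  simp only [sumGraph, Submodule.mem_sup, Submodule.mem_map]
  constructor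
  · rintro ⟨_, ⟨u, hu, rfl⟩, _, ⟨v, hv, rfl⟩, rfl⟩
    exact ⟨u, hu, v, hv, by ext <;> simp [sub_eq_add_neg]⟩
  · rintro ⟨u, hu, v, hv, rfl⟩
    exact ⟨_, ⟨u, hu, rfl⟩, _, ⟨v, hv, rfl⟩, by ext <;> simp [sub_eq_add_neg]⟩

theorem mem_sumOp_domain {Lp Lm : Submodule ℂ E} {x : E} :
    x ∈ (sumOp Lp Lm).domain ↔ ∃ u ∈ Lp, ∃ v ∈ Lm, x = u + v := by
  change x ∈ (sumGraph Lp Lm).map (LinearMap.fst ℂ E E) ↔ _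
  simp only [Submodule.mem_map, mem_sumGraph]
  constructor
  · rintro ⟨_, ⟨u, hu, v, hv, rfl⟩, rfl⟩
    exact ⟨u, hu, v, hv, rfl⟩
  · rintro ⟨u, hu, v, hv, rfl⟩
    exact ⟨_, ⟨u, hu, v, hv, rfl⟩, rfl⟩

theorem sumOp_apply {Lp Lm : Submodule ℂ E} (h : Disjoint Lp Lm) {u v : E} (hu : u ∈ Lp)
    (hv : v ∈ Lm) :
    sumOp Lp Lm ⟨u + v, mem_sumOp_domain.2 ⟨u, hu, v, hv, rfl⟩⟩ = u - v := by
  have key : ∀ x ∈ sumGraph Lp Lm, x.1 = 0 → x.2 = 0 := by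
    intro x hx h0
    obtain ⟨a, ha, b, hb, rfl⟩ := mem_sumGraph.1 hx
    have hab : a = -b := eq_neg_of_add_eq_zero_left h0
    have ha0 : a = 0 := Submodule.disjoint_def.1 h a ha (hab ▸ Lm.neg_mem hb)
    have hb0 : b = 0 := by simpa [ha0] using hab
    simp [ha0, hb0]
  have hg : (sumOp Lp Lm).graph = sumGraph Lp Lm := Submodule.toLinearPMap_graph_eq _ key
  have hm : (u + v, u - v) ∈ (sumOp Lp Lm).graph := by
    rw [hg]; exact mem_sumGraph.2 ⟨u, hu, v, hv, rfl⟩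
  obtain ⟨y, hy1, hy2⟩ := (LinearPMap.mem_graph_iff _).1 hm
  have : y = ⟨u + v, mem_sumOp_domain.2 ⟨u, hu, v, hv, rfl⟩⟩ := Subtype.ext hy1
  rw [← this]; exact hy2

/-- The operator `𝒞₀`, `u + v ↦ u - v`, on `𝔏₊⁰ ∔ 𝔏₋⁰`. -/
def C0 (J : E →L[ℂ] E) (f : ℕ → E) : E →ₗ.[ℂ] E :=
  sumOp (posSpace J f) (negSpace J f)

/-- The operator `G₀ = J 𝒞₀`. -/
def G0 (J : E →L[ℂ] E) (f : ℕ → E) : E →ₗ.[ℂ] E :=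
  (J : E →ₗ[ℂ] E).compPMap (C0 J f)

/-- The quadratic form `(G x, x)` of an operator `G`. -/
def form (G : E →ₗ.[ℂ] E) (x : G.domain) : ℝ :=
  (inner ℂ (x : E) (G x)).re

/-- `x ∈ D[G]`: the vector `x` is the limit in `E` of a sequence in `D(G)` that is Cauchy with
respect to the norm `‖u‖₀² = ‖u‖² + (G u, u)`. -/
def InFormClosure (G : E →ₗ.[ℂ] E) (x : E) : Prop :=
  ∃ u : ℕ → G.domain, Tendsto (fun n => (u n : E)) atTop (𝓝 x) ∧
    Tendsto (fun p : ℕ × ℕ => form G (u p.1 - u p.2)) atTop (𝓝 0)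

/-- The subspace `D[G]` of `E`. For an operator with nonnegative quadratic form the span may be
left out, see `mem_formDomain_iff`. -/
def formDomain (G : E →ₗ.[ℂ] E) : Submodule ℂ E :=
  Submodule.span ℂ {x | InFormClosure G x}

theorem mem_formDomain_iff {G : E →ₗ.[ℂ] E} (hG : ∀ x, 0 ≤ form G x) {x : E} :
    x ∈ formDomain G ↔ InFormClosure G x := by
  refine ⟨fun hx => ?_, fun hx => Submodule.subset_span hx⟩
  induction hx using Submodule.span_induction with
  | mem x hx => exact hx
  | zero => exact ⟨0, by simp, by simp [form]⟩
  | add x y _ _ hx hy =>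
    obtain ⟨u, hu, hu'⟩ := hx
    obtain ⟨v, hv, hv'⟩ := hy
    refine ⟨u + v, by simpa using hu.add hv, ?_⟩
    have hb : Tendsto (fun p : ℕ × ℕ => 2 * form G (u p.1 - u p.2) + 2 * form G (v p.1 - v p.2))
        atTop (𝓝 0) := by
      simpa using (hu'.const_mul 2).add (hv'.const_mul 2)
    refine squeeze_zero (fun _ => hG _) (fun p => ?_) hb
    have e : (u + v) p.1 - (u + v) p.2 = (u p.1 - u p.2) + (v p.1 - v p.2) := by
      simp only [Pi.add_apply]; abel
    have par : ∀ a b : G.domain,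
        form G (a + b) + form G (a - b) = 2 * form G a + 2 * form G b := by
      intro a b
      simp only [form, LinearPMap.map_add, LinearPMap.map_sub, Submodule.coe_add,
        Submodule.coe_sub, inner_add_left, inner_add_right, inner_sub_left, inner_sub_right,
        Complex.add_re, Complex.sub_re]
      ring
    rw [e]
    linarith [par (u p.1 - u p.2) (v p.1 - v p.2),
      hG ((u p.1 - u p.2) - (v p.1 - v p.2))]
  | smul c x _ hx =>
    obtain ⟨u, hu, hu'⟩ := hx
    refine ⟨fun n => c • u n, by simpa using hu.const_smul c, ?_⟩
    have hs : ∀ a : G.domain, form G (c • a) = ‖c‖ ^ 2 * form G a := by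
      intro a
      simp only [form, LinearPMap.map_smul, Submodule.coe_smul, inner_smul_left, inner_smul_right]
      rw [← mul_assoc, Complex.mul_conj', ← Complex.ofReal_pow, Complex.re_ofReal_mul]
    have : (fun p : ℕ × ℕ => form G (c • u p.1 - c • u p.2)) =
        fun p : ℕ × ℕ => ‖c‖ ^ 2 * form G (u p.1 - u p.2) := by
      funext p; rw [← smul_sub, hs]
    rw [this]
    simpa using hu'.const_mul (‖c‖ ^ 2)

/-- The Friedrichs extension `G_F`: the restriction of `G*` to `D[G] ∩ D(G*)`. -/
def friedrichs [CompleteSpace E] (G : E →ₗ.[ℂ] E) : E →ₗ.[ℂ] E :=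
  G.adjoint.domRestrict (formDomain G)

/-- `𝒞` is an operator of `𝒞`-symmetry in the Krein space given by `J`: `𝒞² x = x` for all
`x ∈ D(𝒞)`, and `J𝒞` is a positive self-adjoint operator. -/
structure IsCSymmetry [CompleteSpace E] (J : E →L[ℂ] E) (C : E →ₗ.[ℂ] E) : Prop where
  map_mem : ∀ x : C.domain, C x ∈ C.domain
  sq_apply : ∀ x : C.domain, C ⟨C x, map_mem x⟩ = x
  selfAdjoint : IsSelfAdjoint ((J : E →ₗ[ℂ] E).compPMap C)
  pos : ∀ x : C.domain, x ≠ 0 → 0 < (krein J (C x) x).re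

section Space

variable [CompleteSpace E] {J : E →L[ℂ] E} {C : E →ₗ.[ℂ] E}

theorem IsCSymmetry.symm (hC : IsCSymmetry J C) (x y : C.domain) :
    inner ℂ (J (C x)) (y : E) = inner ℂ (x : E) (J (C y)) := by
  have hd := hC.selfAdjoint.dense_domain
  have h := LinearPMap.adjoint_isFormalAdjoint hd
  rw [LinearPMap.isSelfAdjoint_def.1 hC.selfAdjoint] at h
  exact h x y

/-- The domain `D(𝒞)`, to be equipped with the inner product `(x, y)_𝒞 = [𝒞 x, y]`. -/
def PreHC (_hC : IsCSymmetry J C) : Type _ := C.domain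

instance (hC : IsCSymmetry J C) : AddCommGroup (PreHC hC) :=
  inferInstanceAs (AddCommGroup C.domain)

instance (hC : IsCSymmetry J C) : Module ℂ (PreHC hC) :=
  inferInstanceAs (Module ℂ C.domain)

/-- The inner product `(x, y)_𝒞 = [𝒞 x, y]` on `D(𝒞)`; in Mathlib's convention, where the second
argument is the linear one, `inner ℂ x y` is `(y, x)_𝒞`. -/
@[reducible] def innerCore (hC : IsCSymmetry J C) : InnerProductSpace.Core ℂ (PreHC hC) where
  inner x y := krein J (C (show C.domain from y)) (show C.domain from x)
  conj_inner_symm x y := by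
    change starRingEnd ℂ (inner ℂ _ (J (C _))) = inner ℂ _ (J (C _))
    rw [inner_conj_symm]
    exact hC.symm _ _
  re_inner_nonneg x := by
    by_cases h : (show C.domain from x) = 0
    · have hx : (x : PreHC hC) = 0 := h
      subst hx
      change 0 ≤ (krein J (C (0 : C.domain)) (0 : C.domain)).re
      simp [krein]
    · exact (hC.pos _ h).le
  add_left x y z := by
    change inner ℂ (((show C.domain from x) + (show C.domain from y) : C.domain) : E) _ = _
    rw [Submodule.coe_add, inner_add_left]; rfl
  smul_left x y r := by
    change inner ℂ ((r • (show C.domain from x) : C.domain) : E) _ = _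
    rw [Submodule.coe_smul, inner_smul_left]; rfl
  definite x h := by
    by_contra hx
    have := hC.pos x hx
    change krein J (C (show C.domain from x)) (show C.domain from x) = 0 at h
    exact absurd (congrArg Complex.re h) (ne_of_gt this)

instance (hC : IsCSymmetry J C) : NormedAddCommGroup (PreHC hC) :=
  (innerCore hC).toNormedAddCommGroup

instance (hC : IsCSymmetry J C) : InnerProductSpace ℂ (PreHC hC) :=
  InnerProductSpace.ofCore (innerCore hC).toCore

/-- The Hilbert space `ℌ_𝒞`: the completion of `D(𝒞)` with respect to `(·, ·)_𝒞`. -/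
abbrev HC (hC : IsCSymmetry J C) : Type _ := UniformSpace.Completion (PreHC hC)

/-- The canonical embedding of `D(𝒞)` into `ℌ_𝒞`. -/
def toHC (hC : IsCSymmetry J C) (x : C.domain) : HC hC :=
  ((show PreHC hC from x : PreHC hC) : UniformSpace.Completion (PreHC hC))

end Space

end KreinC

end

noncomputable section

namespace KreinC

variable {E : Type*} [NormedAddCommGroup E] [InnerProductSpace ℂ E]

/-! Distinct real eigenvalues make the `f n` `J`-orthogonal, so `𝔏₊⁰` and `𝔏₋⁰` are `J`-orthogonal
and, by completeness, meet only in `0`. Hence `G₀` is symmetric and `𝒞₀ ⊆ J G_F = 𝒞`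
(`C0_le_compPMap_friedrichs`). So `𝒞 f n = ± f n` with the sign of `[f n, f n]`, which gives
orthonormality.

Totality is the real issue, since density in `E` says nothing about the norm of `ℌ_𝒞`. The tool is
`tendsto_toHC`: a `𝒞`-Cauchy sequence in `D(𝒞)` whose limit in `E` lies in `D(𝒞)` has the same limit
in `ℌ_𝒞`. It is used twice. On `𝔏±⁰` the form is `±[·,·]`, bounded in the norm of `E`, so the closed
span of the `f n` in `ℌ_𝒞` contains `D(𝒞₀)`. Then `D(𝒞) ⊆ D[G₀]`, the defining property of the
Friedrichs extension, carries this from `D(𝒞₀)` to `D(𝒞)`, which is dense in `ℌ_𝒞`. -/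

theorem krein_conj_symm [CompleteSpace E] {J : E →L[ℂ] E} (hJ : IsSelfAdjoint J) (x y : E) :
    starRingEnd ℂ (krein J y x) = krein J x y := by
  have h := hJ.isSymmetric y x
  simp only [ContinuousLinearMap.coe_coe] at h
  rw [krein, krein, inner_conj_symm, h]

theorem krein_eq_zero_of_mem_closure_left {J : E →L[ℂ] E} {s : Set E} {x y : E}
    (h : ∀ a ∈ s, krein J a y = 0) (hx : x ∈ (Submodule.span ℂ s).topologicalClosure) :
    krein J x y = 0 := by
  have hle : (Submodule.span ℂ s).topologicalClosure ≤ (innerSL ℂ y ∘L J).ker :=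
    Submodule.topologicalClosure_minimal _ (Submodule.span_le.2 fun a ha => h a ha)
      (innerSL ℂ y ∘L J).isClosed_ker
  exact hle hx

theorem krein_eq_zero_of_mem_closure [CompleteSpace E] {J : E →L[ℂ] E} (hJ : IsSelfAdjoint J)
    {s t : Set E} {x y : E} (h : ∀ a ∈ s, ∀ b ∈ t, krein J a b = 0)
    (hx : x ∈ (Submodule.span ℂ s).topologicalClosure)
    (hy : y ∈ (Submodule.span ℂ t).topologicalClosure) : krein J x y = 0 := by
  refine krein_eq_zero_of_mem_closure_left (fun a ha => ?_) hx
  rw [← krein_conj_symm hJ, krein_eq_zero_of_mem_closure_left (fun b hb => ?_) hy, map_zero]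
  rw [← krein_conj_symm hJ, h a ha b hb, map_zero]

/-- Eigenvectors of a `J`-symmetric operator for distinct real eigenvalues are `J`-orthogonal. -/
theorem krein_eigenvectors_eq_zero {J : E →L[ℂ] E} {H : E →ₗ.[ℂ] E} (hH : IsJSymmetric J H)
    {lam : ℕ → ℝ} {f : ℕ → E} (hf : IsCompleteEigensystem H lam f) {n m : ℕ} (hnm : n ≠ m) :
    krein J (f n) (f m) = 0 := by
  have h := hH ⟨f n, hf.mem_domain n⟩ ⟨f m, hf.mem_domain m⟩
  rw [hf.eigen, hf.eigen] at h
  simp only [krein, map_smul, inner_smul_left, inner_smul_right, Complex.conj_ofReal] at h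
  have hne : (lam n : ℂ) - lam m ≠ 0 := by
    rw [sub_ne_zero]
    exact fun e => hnm (hf.distinct (Complex.ofReal_injective e))
  refine (mul_eq_zero.1 (?_ : ((lam n : ℂ) - lam m) * krein J (f n) (f m) = 0)).resolve_left hne
  rw [krein, sub_mul, h, sub_self]

theorem eigenvector_mem_posSpace {J : E →L[ℂ] E} {f : ℕ → E} {n : ℕ} (hn : 0 < (krein J (f n) (f n)).re) :
    f n ∈ posSpace J f :=
  Submodule.le_topologicalClosure _ (Submodule.subset_span ⟨n, hn, rfl⟩)

theorem eigenvector_mem_negSpace {J : E →L[ℂ] E} {f : ℕ → E} {n : ℕ} (hn : (krein J (f n) (f n)).re < 0) :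
    f n ∈ negSpace J f :=
  Submodule.le_topologicalClosure _ (Submodule.subset_span ⟨n, hn, rfl⟩)

theorem eigenvector_mem_C0_domain {J : E →L[ℂ] E} {f : ℕ → E}
    (hne : ∀ n, (krein J (f n) (f n)).re ≠ 0) (n : ℕ) :
    f n ∈ (C0 J f).domain := by
  rw [C0, mem_sumOp_domain]
  rcases (hne n).lt_or_gt with h | h
  · exact ⟨0, zero_mem _, f n, eigenvector_mem_negSpace h, by simp⟩
  · exact ⟨f n, eigenvector_mem_posSpace h, 0, zero_mem _, by simp⟩

theorem apply_posSpace_of_C0_le {J : E →L[ℂ] E} {f : ℕ → E} {C : E →ₗ.[ℂ] E}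
    (hdis : Disjoint (posSpace J f) (negSpace J f)) (hle : C0 J f ≤ C)
    {u : E} (hu : u ∈ posSpace J f) (h : u ∈ C.domain) : C ⟨u, h⟩ = u := by
  have hd : u + 0 ∈ (C0 J f).domain := mem_sumOp_domain.2 ⟨u, hu, 0, zero_mem _, rfl⟩
  have e : C0 J f ⟨u + 0, hd⟩ = u - 0 := sumOp_apply hdis hu (zero_mem _)
  have h' : C0 J f ⟨u + 0, hd⟩ = C ⟨u, h⟩ := hle.2 (add_zero u)
  rw [← h', e, sub_zero]

theorem apply_negSpace_of_C0_le {J : E →L[ℂ] E} {f : ℕ → E} {C : E →ₗ.[ℂ] E}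
    (hdis : Disjoint (posSpace J f) (negSpace J f)) (hle : C0 J f ≤ C)
    {v : E} (hv : v ∈ negSpace J f) (h : v ∈ C.domain) : C ⟨v, h⟩ = -v := by
  have hd : 0 + v ∈ (C0 J f).domain := mem_sumOp_domain.2 ⟨0, zero_mem _, v, hv, rfl⟩
  have e : C0 J f ⟨0 + v, hd⟩ = 0 - v := sumOp_apply hdis (zero_mem _) hv
  have h' : C0 J f ⟨0 + v, hd⟩ = C ⟨v, h⟩ := hle.2 (zero_add v)
  rw [← h', e, zero_sub]

/-! ### The subspaces `𝔏±⁰` and the inclusion `𝒞₀ ⊆ J G_F`. -/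

section Fundamental

variable [CompleteSpace E] {J : E →L[ℂ] E} {f : ℕ → E}

theorem krein_posSpace_negSpace (hJ : IsSelfAdjoint J)
    (horth : Pairwise fun n m => krein J (f n) (f m) = 0) {u v : E}
    (hu : u ∈ posSpace J f) (hv : v ∈ negSpace J f) : krein J u v = 0 := by
  refine krein_eq_zero_of_mem_closure hJ ?_ hu hv
  rintro _ ⟨n, hn, rfl⟩ _ ⟨m, hm, rfl⟩
  refine horth fun e => ?_
  subst e
  have hn' : 0 < (krein J (f n) (f n)).re := hn
  have hm' : (krein J (f n) (f n)).re < 0 := hm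
  exact lt_asymm hn' hm'

theorem krein_negSpace_posSpace (hJ : IsSelfAdjoint J)
    (horth : Pairwise fun n m => krein J (f n) (f m) = 0) {u v : E}
    (hu : u ∈ posSpace J f) (hv : v ∈ negSpace J f) : krein J v u = 0 := by
  rw [← krein_conj_symm hJ, krein_posSpace_negSpace hJ horth hu hv, map_zero]

/-- A common vector is `J`-orthogonal to every `f n`, hence to all of `E` by density, and `[·,·]` is
nondegenerate. -/
theorem disjoint_posSpace_negSpace (hJ : IsFundamentalSymmetry J)
    (horth : Pairwise fun n m => krein J (f n) (f m) = 0)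
    (hne : ∀ n, (krein J (f n) (f n)).re ≠ 0)
    (hdense : Dense (Submodule.span ℂ (Set.range f) : Set E)) :
    Disjoint (posSpace J f) (negSpace J f) := by
  rw [Submodule.disjoint_def]
  intro x hp hm
  have h0 : ∀ n, krein J (f n) x = 0 := fun n => by
    rcases (hne n).lt_or_gt with h | h
    · exact krein_negSpace_posSpace hJ.selfAdjoint horth hp (eigenvector_mem_negSpace h)
    · exact krein_posSpace_negSpace hJ.selfAdjoint horth (eigenvector_mem_posSpace h) hm
  -- Tested against `J x`, because `[J x, x] = (J² x, x) = ‖x‖²`.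
  have hxx : krein J (J x) x = 0 := by
    refine krein_eq_zero_of_mem_closure_left (s := Set.range f) ?_ (hdense (J x))
    rintro _ ⟨n, rfl⟩
    exact h0 n
  have hJJ : J (J x) = x := by
    simpa using DFunLike.congr_fun hJ.sq_eq_one x
  rw [krein, hJJ] at hxx
  exact inner_self_eq_zero.1 hxx

theorem G0_isFormalAdjoint (hJ : IsSelfAdjoint J)
    (horth : Pairwise fun n m => krein J (f n) (f m) = 0)
    (hdis : Disjoint (posSpace J f) (negSpace J f)) : (G0 J f).IsFormalAdjoint (G0 J f) := by
  rintro ⟨x, hx⟩ ⟨y, hy⟩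
  obtain ⟨u, hu, v, hv, rfl⟩ := mem_sumOp_domain.1 hx
  obtain ⟨a, ha, b, hb, rfl⟩ := mem_sumOp_domain.1 hy
  have e1 : G0 J f ⟨u + v, hx⟩ = J (u - v) := congrArg J (sumOp_apply hdis hu hv)
  have e2 : G0 J f ⟨a + b, hy⟩ = J (a - b) := congrArg J (sumOp_apply hdis ha hb)
  have hs : inner ℂ (J (u - v)) (a + b) = inner ℂ (u - v) (J (a + b)) := hJ.isSymmetric _ _
  have h1 : inner ℂ u (J b) = 0 := krein_negSpace_posSpace hJ horth hu hb
  have h2 : inner ℂ v (J a) = 0 := krein_posSpace_negSpace hJ horth ha hv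
  rw [e1, e2, hs]
  simp only [map_add, map_sub, inner_add_left, inner_add_right, inner_sub_left, inner_sub_right,
    h1, h2]
  ring

/-- Symmetry puts `G` inside its adjoint, and constant sequences put `D(G)` inside `D[G]`. -/
theorem le_friedrichs {G : E →ₗ.[ℂ] E} (hd : Dense (G.domain : Set E))
    (hG : G.IsFormalAdjoint G) : G ≤ friedrichs G := by
  have hle : G ≤ G.adjoint := hG.le_adjoint hd
  refine ⟨fun x hx => ⟨Submodule.subset_span ?_, hle.1 hx⟩, fun x y hxy => ?_⟩
  · exact ⟨fun _ => ⟨x, hx⟩, tendsto_const_nhds, by simp [form]⟩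
  · have h : (y : E) ∈ G.adjoint.domain := y.2.2
    have hy : friedrichs G y = G.adjoint ⟨y, h⟩ := LinearPMap.domRestrict_apply rfl
    rw [hy]
    exact hle.2 hxy

/-- `𝒞₀ ⊆ J G_F`. -/
theorem C0_le_compPMap_friedrichs (hJ : IsFundamentalSymmetry J)
    (horth : Pairwise fun n m => krein J (f n) (f m) = 0)
    (hne : ∀ n, (krein J (f n) (f n)).re ≠ 0)
    (hdense : Dense (Submodule.span ℂ (Set.range f) : Set E)) :
    C0 J f ≤ (J : E →ₗ[ℂ] E).compPMap (friedrichs (G0 J f)) := by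
  have hdis := disjoint_posSpace_negSpace hJ horth hne hdense
  have hd : Dense ((G0 J f).domain : Set E) := by
    refine hdense.mono (Submodule.span_le.2 ?_)
    rintro _ ⟨n, rfl⟩
    exact eigenvector_mem_C0_domain hne n
  have hle := le_friedrichs hd (G0_isFormalAdjoint hJ.selfAdjoint horth hdis)
  refine ⟨hle.1, fun x y hxy => ?_⟩
  have h : G0 J f x = friedrichs (G0 J f) y := hle.2 hxy
  change C0 J f x = J (friedrichs (G0 J f) y)
  rw [← h]
  change _ = J (J (C0 J f x))
  simpa using (DFunLike.congr_fun hJ.sq_eq_one (C0 J f x)).symm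

end Fundamental

/-! ### Convergence, totality and orthonormality in `ℌ_𝒞`. -/

section Completion

variable [CompleteSpace E] {J : E →L[ℂ] E} {C : E →ₗ.[ℂ] E}

/-- The embedding `toHC` as a linear map. -/
def toHCₗ (hC : IsCSymmetry J C) : C.domain →ₗ[ℂ] HC hC where
  toFun := toHC hC
  map_add' x y := UniformSpace.Completion.coe_add (α := PreHC hC) x y
  map_smul' c x := UniformSpace.Completion.coe_smul (X := PreHC hC) c x

theorem inner_toHC (hC : IsCSymmetry J C) (x y : C.domain) :
    inner ℂ (toHC hC x) (toHC hC y) = krein J (C y) x :=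
  UniformSpace.Completion.inner_coe (E := PreHC hC) x y

theorem norm_toHC_sq (hC : IsCSymmetry J C) (x : C.domain) :
    ‖toHC hC x‖ ^ 2 = (krein J (C x) x).re := by
  rw [← inner_toHC hC]
  exact (inner_self_eq_norm_sq (𝕜 := ℂ) _).symm

theorem denseRange_toHC (hC : IsCSymmetry J C) : DenseRange (toHC hC) :=
  UniformSpace.Completion.denseRange_coe (α := PreHC hC)

/-- Closability of the form `(·, ·)_𝒞`: if `u n → x` in the original space and `u` is Cauchy with
respect to `(·, ·)_𝒞`, then `u n → x` in `ℌ_𝒞`. -/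
theorem tendsto_toHC (hC : IsCSymmetry J C) {u : ℕ → C.domain} {x : C.domain}
    (hu : Tendsto (fun n => (u n : E)) atTop (𝓝 x))
    (hcau : Tendsto (fun p : ℕ × ℕ => (krein J (C (u p.1 - u p.2)) (u p.1 - u p.2 : C.domain)).re)
      atTop (𝓝 0)) :
    Tendsto (fun n => toHC hC (u n)) atTop (𝓝 (toHC hC x)) := by
  have hc : CauchySeq fun n => toHC hC (u n) := by
    rw [cauchySeq_iff_tendsto_dist_atTop_0]
    have h := hcau.sqrt
    rw [Real.sqrt_zero] at h
    refine h.congr fun p => ?_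
    have hsub : toHC hC (u p.1 - u p.2) = toHC hC (u p.1) - toHC hC (u p.2) :=
      map_sub (toHCₗ hC) _ _
    rw [← norm_toHC_sq hC, Real.sqrt_sq (norm_nonneg _), dist_eq_norm, hsub]
  obtain ⟨z, hz⟩ := cauchySeq_tendsto_of_complete hc
  have hzx : z = toHC hC x := by
    -- Pairing with `y ∈ D(𝒞)` moves `J𝒞` onto `y`, and the result is continuous in the norm of `E`.
    -- This identifies the abstract limit `z`.
    refine (denseRange_toHC hC).eq_of_inner_left ℂ fun y => ?_
    have h1 : Tendsto (fun n => inner ℂ (toHC hC (u n)) (toHC hC y)) atTop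
        (𝓝 (inner ℂ z (toHC hC y))) := hz.inner tendsto_const_nhds
    have h2 : Tendsto (fun n => inner ℂ (toHC hC (u n)) (toHC hC y)) atTop
        (𝓝 (inner ℂ (toHC hC x) (toHC hC y))) := by
      simp only [inner_toHC, krein]
      exact hu.inner tendsto_const_nhds
    exact tendsto_nhds_unique h1 h2
  exact hzx ▸ hz

/-- On a subspace where `𝒞` is multiplication by `c`, closures in the original space are
contained in closures in `ℌ_𝒞`. -/
theorem toHC_mem_of_mem_closure (hC : IsCSymmetry J C) {s : Set E} {c : ℂ} {K : Submodule ℂ (HC hC)}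
    (hK : IsClosed (K : Set (HC hC)))
    (hdom : (Submodule.span ℂ s).topologicalClosure ≤ C.domain)
    (hc : ∀ x : C.domain, (x : E) ∈ (Submodule.span ℂ s).topologicalClosure → C x = c • (x : E))
    (hs : ∀ x : C.domain, (x : E) ∈ s → toHC hC x ∈ K) {x : C.domain}
    (hx : (x : E) ∈ (Submodule.span ℂ s).topologicalClosure) : toHC hC x ∈ K := by
  have hle := (Submodule.span ℂ s).le_topologicalClosure
  have hspan : Submodule.span ℂ s ≤ (K.comap (toHCₗ hC)).map C.domain.subtype :=
    Submodule.span_le.2 fun a ha =>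
      ⟨⟨a, hdom (hle (Submodule.subset_span ha))⟩, hs _ ha, rfl⟩
  obtain ⟨a, ha, hax⟩ := mem_closure_iff_seq_limit.1 hx
  choose u hu hua using fun n => hspan (ha n)
  have hua' : ∀ n, (u n : E) = a n := hua
  have hlim : Tendsto (fun n => (u n : E)) atTop (𝓝 x) := by simpa only [hua'] using hax
  refine hK.mem_of_tendsto (tendsto_toHC hC hlim ?_) (Eventually.of_forall hu)
  -- Differences stay in the closed span, so their form is `c [w, w]`, which tends to `0` with `w`
  -- in `E`.
  have heq : ∀ p : ℕ × ℕ, C (u p.1 - u p.2) = c • ((u p.1 : E) - u p.2) := fun p =>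
    hc _ (hle (by simpa only [Submodule.coe_sub, hua'] using Submodule.sub_mem _ (ha _) (ha _)))
  simp only [heq, krein, Submodule.coe_sub, map_smul, inner_smul_right]
  have hd : Tendsto (fun p : ℕ × ℕ => (u p.1 : E) - u p.2) atTop (𝓝 0) := by
    rw [← prod_atTop_atTop_eq, ← sub_self (x : E)]
    exact (hlim.comp tendsto_fst).sub (hlim.comp tendsto_snd)
  have hcont : Continuous fun w : E => (c * inner ℂ w (J w)).re := by fun_prop
  have h0 := (hcont.tendsto 0).comp hd
  rw [inner_zero_left, mul_zero, Complex.zero_re] at h0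
  exact h0

variable {f : ℕ → E}

/-- If `𝒞₀ ⊆ 𝒞` and `D(𝒞) ⊆ D[G₀]`, then the images in `ℌ_𝒞` of the `f n` are total. -/
theorem span_toHC_topologicalClosure_eq_top (hC : IsCSymmetry J C)
    (hdis : Disjoint (posSpace J f) (negSpace J f)) (hle : C0 J f ≤ C)
    (hform : C.domain ≤ formDomain (G0 J f)) (hmem : ∀ n, f n ∈ C.domain) :
    (Submodule.span ℂ (Set.range fun n => toHC hC ⟨f n, hmem n⟩)).topologicalClosure = ⊤ := by
  set K := (Submodule.span ℂ (Set.range fun n => toHC hC ⟨f n, hmem n⟩)).topologicalClosure with hKd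
  have hK : IsClosed (K : Set (HC hC)) := Submodule.isClosed_topologicalClosure _
  have hfK : ∀ n, toHC hC ⟨f n, hmem n⟩ ∈ K := fun n =>
    Submodule.le_topologicalClosure _ (Submodule.subset_span ⟨n, rfl⟩)
  have himg : ∀ (s : Set ℕ) (x : C.domain), (x : E) ∈ f '' s → toHC hC x ∈ K := by
    rintro s ⟨_, h⟩ ⟨n, -, rfl⟩
    exact hfK n
  have hposd : posSpace J f ≤ C.domain := fun u hu =>
    hle.1 (mem_sumOp_domain.2 ⟨u, hu, 0, zero_mem _, (add_zero u).symm⟩)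
  have hnegd : negSpace J f ≤ C.domain := fun v hv =>
    hle.1 (mem_sumOp_domain.2 ⟨0, zero_mem _, v, hv, (zero_add v).symm⟩)
  have hpos : ∀ x : C.domain, (x : E) ∈ posSpace J f → toHC hC x ∈ K := fun x hx =>
    toHC_mem_of_mem_closure hC (c := 1) hK hposd
      (fun y hy => by rw [one_smul]; exact apply_posSpace_of_C0_le hdis hle hy y.2) (himg _) hx
  have hneg : ∀ x : C.domain, (x : E) ∈ negSpace J f → toHC hC x ∈ K := fun x hx =>
    toHC_mem_of_mem_closure hC (c := -1) hK hnegd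
      (fun y hy => by rw [neg_one_smul]; exact apply_negSpace_of_C0_le hdis hle hy y.2)
      (himg _) hx
  have hD0 : ∀ x : C.domain, (x : E) ∈ (C0 J f).domain → toHC hC x ∈ K := by
    rintro ⟨_, h⟩ hx
    obtain ⟨u, hu, v, hv, rfl⟩ := mem_sumOp_domain.1 hx
    have hadd : toHC hC ⟨u + v, h⟩ = toHC hC ⟨u, hposd hu⟩ + toHC hC ⟨v, hnegd hv⟩ :=
      map_add (toHCₗ hC) ⟨u, hposd hu⟩ ⟨v, hnegd hv⟩
    rw [hadd]
    exact K.add_mem (hpos _ hu) (hneg _ hv)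
  -- On `D(𝒞₀)` the form of `G₀` is the squared norm of `ℌ_𝒞`. Its nonnegativity and the Cauchy
  -- condition in `D[G₀]` can therefore be read in `ℌ_𝒞`.
  have hformeq : ∀ x : (G0 J f).domain,
      form (G0 J f) x = (krein J (C ⟨x, hle.1 x.2⟩) x).re := fun x => by
    have h : C0 J f x = C ⟨x, hle.1 x.2⟩ := hle.2 rfl
    rw [← h]
    rfl
  have hnonneg : ∀ x, 0 ≤ form (G0 J f) x := fun x => by
    rw [hformeq, ← norm_toHC_sq hC ⟨x, hle.1 x.2⟩]
    positivity
  have hall : ∀ x : C.domain, toHC hC x ∈ K := fun x => by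
    -- The Friedrichs property enters here: every `x ∈ D(𝒞)` is a form limit of vectors of `D(𝒞₀)`.
    obtain ⟨u, hux, hu⟩ := (mem_formDomain_iff hnonneg).1 (hform x.2)
    refine hK.mem_of_tendsto (tendsto_toHC hC (u := fun n => ⟨u n, hle.1 (u n).2⟩) hux ?_)
      (Eventually.of_forall fun n => hD0 _ (u n).2)
    exact hu.congr fun p => hformeq _
  refine (Submodule.eq_top_iff'.2 fun z => ?_)
  exact hK.closure_subset_iff.2 (Set.range_subset_iff.2 hall) (denseRange_toHC hC z)

/-- The sign in `𝒞 f m = ± f m` cancels that of `[f m, f m] = ±1`. -/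
theorem orthonormal_toHC (hC : IsCSymmetry J C)
    (horth : Pairwise fun n m => krein J (f n) (f m) = 0)
    (hnorm : ∀ n, krein J (f n) (f n) = 1 ∨ krein J (f n) (f n) = -1)
    (hdis : Disjoint (posSpace J f) (negSpace J f)) (hle : C0 J f ≤ C)
    (hmem : ∀ n, f n ∈ C.domain) : Orthonormal ℂ fun n => toHC hC ⟨f n, hmem n⟩ := by
  rw [orthonormal_iff_ite]
  intro n m
  rw [inner_toHC]
  rcases hnorm m with h | h
  · rw [apply_posSpace_of_C0_le hdis hle (eigenvector_mem_posSpace (by simp [h]))]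
    split_ifs with hnm
    · rw [hnm, h]
    · exact horth (Ne.symm hnm)
  · rw [apply_negSpace_of_C0_le hdis hle (eigenvector_mem_negSpace (by simp [h]))]
    have hneg : krein J (-f m) (f n) = -krein J (f m) (f n) := by simp [krein]
    change krein J (-f m) (f n) = _
    rw [hneg]
    split_ifs with hnm
    · rw [hnm, h, neg_neg]
    · rw [horth (Ne.symm hnm), neg_zero]

end Completion

end KreinC

end

open KreinC in
theorem mainTheorem8 {E : Type*} [NormedAddCommGroup E] [InnerProductSpace ℂ E] [CompleteSpace E]
    (J : E →L[ℂ] E) (hJ : IsFundamentalSymmetry J)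
    (H : E →ₗ.[ℂ] E) (hH : IsJSymmetric J H)
    (lam : ℕ → ℝ) (f : ℕ → E) (hf : IsCompleteEigensystem H lam f)
    (hnorm : ∀ n, krein J (f n) (f n) ^ 2 = 1)
    (C : E →ₗ.[ℂ] E) (hC : IsCSymmetry J C)
    (hCF : C = (J : E →ₗ[ℂ] E).compPMap (friedrichs (G0 J f))) :
    ∃ hmem : ∀ n, f n ∈ C.domain, ∃ b : HilbertBasis ℕ ℂ (HC hC),
      ∀ n, b n = toHC hC ⟨f n, hmem n⟩ := by
  have horth : Pairwise fun n m => krein J (f n) (f m) = 0 := fun _ _ hnm =>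
    krein_eigenvectors_eq_zero hH hf hnm
  have hsign : ∀ n, krein J (f n) (f n) = 1 ∨ krein J (f n) (f n) = -1 := fun n =>
    sq_eq_one_iff.1 (hnorm n)
  have hne : ∀ n, (krein J (f n) (f n)).re ≠ 0 := fun n => by
    rcases hsign n with h | h <;> simp [h]
  have hdis := disjoint_posSpace_negSpace hJ horth hne hf.complete
  have hle : C0 J f ≤ C := hCF ▸ C0_le_compPMap_friedrichs hJ horth hne hf.complete
  have hform : C.domain ≤ formDomain (G0 J f) := by
    rw [hCF]
    exact fun _ hx => hx.1
  have hmem : ∀ n, f n ∈ C.domain := fun n => hle.1 (eigenvector_mem_C0_domain hne n)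
  refine ⟨hmem, HilbertBasis.mk (orthonormal_toHC hC horth hsign hdis hle hmem)
    (span_toHC_topologicalClosure_eq_top hC hdis hle hform hmem).ge, fun n => ?_⟩
  rw [HilbertBasis.coe_mk]
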